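/- Consider classical randomized two-party protocols with private coins: Al holds $x\in\{0,1\}^n$, Bob holds $y\in\{0,1\}^n$, they exchange finitely many messages (bit strings) in rounds, each message depending on the sender's input, his private coins (independent of the inputs and of the other player's coins) and the messages exchanged so far, and at the end both know the result, which is determined by the exchanged messages. A protocol computes $f:\{0,1\}^n\times\{0,1\}^n\to\{0,1\}$ with error $\epsilon$ if for all $x,y$ the result is $f(x,y)$ with probability at least $1-\epsilon$. If the inputs $(X,Y)$ are drawn from a distribution $\mu$ and $A_t$, $B_t$ denote the private storage of Al and Bob after $t$ rounds (own coins and all messages exchanged so far), then the information divulged at time $t$ is $I(A_t:Y\mid X,f(X,Y))$ to Al and $I(B_t:X\mid Y,f(X,Y))$ to Bob, where $I$ is Shannon conditional mutual information in bits. The privacy loss of the protocol is the supremum of these quantities over all times $t$, both players and all distributions $\mu$ on $\{0,1\}^n\times\{0,1\}^n$, and $CL_\epsilon(f)$ is the infimum of the privacy loss over all such protocols computing $f$ with error $\epsilon$. Let $DISJ_n(x,y)=1$ if there is no $i$ with $x_i=y_i=1$, and $DISJ_n(x,y)=0$ otherwise. Then $$CL_{1/3}(DISJ_n)=\Omega\left(\frac{\sqrt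 n}{\log n}\right),$$ i.e. there are constants $c>0$ and $N$ such that for all $n\ge N$ every classical randomized protocol for $DISJ_n$ with error $1/3$ has privacy loss at least $c\sqrt n/\log_2 n$. -/

import Mathlib

namespace ApproxPrivacy

/-! ### Information theory for random variables on a finite probability space

A distribution on a finite type `Ω` is an element `p` of `stdSimplex ℝ Ω`; a random variable is a
function on `Ω`. Entropies are in bits. -/

section Information

variable {Ω S T W : Type*} [Fintype Ω]

open Classical in
/-- The probability of the event `E` under the weights `p`. -/
noncomputable def prob (p : Ω → ℝ) (E : Ω → Prop) : ℝ :=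
  ∑ ω, if E ω then p ω else 0

open Classical in
/-- The Shannon entropy `H(U) = -∑ₛ P(U = s) log₂ P(U = s)`; the sum is over the values that `U`
takes on the sample space. -/
noncomputable def entropy (p : Ω → ℝ) (U : Ω → S) : ℝ :=
  -∑ s ∈ Finset.univ.image U,
    prob p (fun ω => U ω = s) * Real.logb 2 (prob p (fun ω => U ω = s))

/-- The conditional mutual information `I(U : V | C) = H(UC) + H(VC) - H(C) - H(UVC)`. -/
noncomputable def condMutualInfo (p : Ω → ℝ) (U : Ω → S) (V : Ω → T) (C : Ω → W) : ℝ :=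
  entropy p (fun ω => (U ω, C ω)) + entropy p (fun ω => (V ω, C ω))
    - entropy p C - entropy p (fun ω => (U ω, V ω, C ω))

end Information

/-! ### Classical randomized two-party protocols -/

/-- The two players. -/
inductive Player where
  | al
  | bob

/-- A message is a string of bits. -/
abbrev Message : Type := List Bool

/-- The sequence of the messages exchanged so far, in chronological order. -/
abbrev History : Type := List Message

/-- A classical randomized (private coin) protocol with inputs `x : X` for Al and `y : Y` for Bob
and result in `Z`. Each player has private coins, independent of everything else. In every round
the messages exchanged so far determine whose turn it is, and that player sends a message that
depends on his own input, his own coins and the messages exchanged so far. The result is known to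
both players at the end, i.e. it is determined by the exchanged messages. -/
structure Protocol (X Y Z : Type) where
  CoinA : Type
  CoinB : Type
  [fintypeCoinA : Fintype CoinA]
  [fintypeCoinB : Fintype CoinB]
  coinDistA : stdSimplex ℝ CoinA
  coinDistB : stdSimplex ℝ CoinB
  rounds : ℕ
  turn : History → Player
  sendA : X → CoinA → History → Message
  sendB : Y → CoinB → History → Message
  result : History → Z

namespace Protocol

attribute [instance] Protocol.fintypeCoinA Protocol.fintypeCoinB

variable {X Y Z : Type} (P : Protocol X Y Z)

/-- The messages exchanged in the first `t` rounds on inputs `x`, `y` and coins `a`, `b`. -/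
def history (x : X) (y : Y) (a : P.CoinA) (b : P.CoinB) : ℕ → History
  | 0 => []
  | t + 1 =>
    let h := history x y a b t
    match P.turn h with
    | Player.al => h ++ [P.sendA x a h]
    | Player.bob => h ++ [P.sendB y b h]

/-- The result of the run on inputs `x`, `y` and coins `a`, `b`. -/
def run (x : X) (y : Y) (a : P.CoinA) (b : P.CoinB) : Z :=
  P.result (P.history x y a b P.rounds)

/-- The joint distribution of the two players' coins. -/
def coinWeight (c : P.CoinA × P.CoinB) : ℝ :=
  P.coinDistA.1 c.1 * P.coinDistB.1 c.2

/-- On every input, the probability of the result `f x y` is at least `1 - ε`. -/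
def Computes (f : X → Y → Z) (ε : ℝ) : Prop :=
  ∀ x y, 1 - ε ≤ prob P.coinWeight (fun c => P.run x y c.1 c.2 = f x y)

/-- The joint distribution of the inputs, drawn from `μ`, and of the coins. -/
def weight (μ : X × Y → ℝ) (ω : (X × Y) × (P.CoinA × P.CoinB)) : ℝ :=
  μ ω.1 * P.coinWeight ω.2

/-- Al's private storage after `t` rounds: an honest player may keep his coins and all messages. -/
def storageA (t : ℕ) (ω : (X × Y) × (P.CoinA × P.CoinB)) : P.CoinA × History :=
  (ω.2.1, P.history ω.1.1 ω.1.2 ω.2.1 ω.2.2 t)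

/-- Bob's private storage after `t` rounds. -/
def storageB (t : ℕ) (ω : (X × Y) × (P.CoinA × P.CoinB)) : P.CoinB × History :=
  (ω.2.2, P.history ω.1.1 ω.1.2 ω.2.1 ω.2.2 t)

variable [Fintype X] [Fintype Y]

/-- The information divulged to a player at time `t` if the inputs are drawn from `μ`:
`I(A : Y | X, f(X,Y))` for Al and `I(B : X | Y, f(X,Y))` for Bob. -/
noncomputable def divulged (f : X → Y → Z) (t : ℕ) (μ : X × Y → ℝ) : Player → ℝ
  | Player.al =>
    condMutualInfo (P.weight μ) (P.storageA t) (fun ω => ω.1.2)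
      (fun ω => (ω.1.1, f ω.1.1 ω.1.2))
  | Player.bob =>
    condMutualInfo (P.weight μ) (P.storageB t) (fun ω => ω.1.1)
      (fun ω => (ω.1.2, f ω.1.1 ω.1.2))

/-- The privacy loss of a protocol with respect to `f`: the supremum of the divulged information
over all times, both players and all distributions on the inputs. -/
noncomputable def privacyLoss (f : X → Y → Z) : EReal :=
  ⨆ (t : ℕ) (_ : t ≤ P.rounds) (i : Player) (μ : stdSimplex ℝ (X × Y)),
    (P.divulged f t μ.1 i : EReal)

end Protocol

/-- The classical privacy loss `CL_ε(f)`: the infimum of the privacy loss over all classical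
randomized protocols that compute `f` with error `ε`. -/
noncomputable def classicalPrivacyLoss {X Y Z : Type} [Fintype X] [Fintype Y]
    (ε : ℝ) (f : X → Y → Z) : EReal :=
  ⨅ (P : Protocol X Y Z) (_ : P.Computes f ε), P.privacyLoss f

/-- `DISJ_n`: the value is `true` iff the subsets of `{1, …, n}` with characteristic vectors `x`
and `y` are disjoint. -/
def disj (n : ℕ) (x y : Fin n → Bool) : Bool :=
  decide (∀ i, ¬(x i = true ∧ y i = true))

end ApproxPrivacy

/-!
If the inputs are independent of each other with independent coordinates, and the value of the
function is constant on their support, then the information divulged to a player is superadditive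
over the coordinates of the other player's input. In each coordinate it dominates, up to the factor
`log 2`, the average squared Hellinger distance between the distributions of the transcript with and
without knowledge of that coordinate.

For a set `S` of coordinates, let the inputs be uniformly random subsets of `S` and of its
complement, which are always disjoint. In coordinate `i` this compares the transcripts for the bits
`(1, 0)` and `(0, 0)` if `i ∈ S`, and those for `(0, 1)` and `(0, 0)` otherwise; the distribution of
the other coordinates is the same for `S` and for `S ∪ {i}`. The probability of a transcript is a
product of a factor of Al and a factor of Bob, so by cut and paste the transcripts for `(1, 0)` and
`(0, 1)` are as far apart as those for `(0, 0)` and `(1, 1)`, which a correct protocol has to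
distinguish. Hence on average over `S` every coordinate contributes a constant, and some `S` forces
a privacy loss that is even linear in `n`.
-/

namespace ApproxPrivacy

open Finset

section Hellinger

variable {K : Type*} {A : Finset K} {p q r φ : K → ℝ}

/-- The squared Hellinger distance of the weights `p` and `q` on `A`, normalised so that it is at
most `2` for probability distributions. -/
noncomputable def hellingerSq (A : Finset K) (p q : K → ℝ) : ℝ :=
  ∑ k ∈ A, (√(p k) - √(q k)) ^ 2

lemma hellingerSq_nonneg : 0 ≤ hellingerSq A p q :=
  sum_nonneg fun _ _ => sq_nonneg _

lemma hellingerSq_const_mul {c : ℝ} (hc : 0 ≤ c) :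
    hellingerSq A (fun k => c * p k) (fun k => c * q k) = c * hellingerSq A p q := by
  simp only [hellingerSq, Real.sqrt_mul hc, ← mul_sub, mul_pow, Real.sq_sqrt hc, ← mul_sum]

lemma hellingerSq_eq_sub_sum_sqrt_mul (hp : ∀ k, 0 ≤ p k) (hq : ∀ k, 0 ≤ q k) :
    hellingerSq A p q = ∑ k ∈ A, p k + ∑ k ∈ A, q k - 2 * ∑ k ∈ A, √(p k * q k) := by
  simp only [hellingerSq, mul_sum, ← sum_add_distrib, ← sum_sub_distrib]
  refine sum_congr rfl fun k _ => ?_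
  rw [sub_sq, Real.sq_sqrt (hp k), Real.sq_sqrt (hq k), Real.sqrt_mul (hp k)]
  ring

lemma half_hellingerSq_le_add :
    hellingerSq A p q / 2 ≤ hellingerSq A p r + hellingerSq A q r := by
  simp only [hellingerSq, sum_div, ← sum_add_distrib]
  refine sum_le_sum fun k _ => ?_
  linarith [sq_nonneg (√(p k) - √(r k) + (√(q k) - √(r k)))]

/-- Since `∑ (p - q) φ = ∑ (√p - √q) (√p + √q) (φ - 1 / 2)`, this is the Cauchy–Schwarz inequality;
centring `φ` gives the optimal constant. -/
lemma sq_sum_mul_sub_le_hellingerSq (hp : ∀ k, 0 ≤ p k) (hq : ∀ k, 0 ≤ q k)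
    (hp1 : ∑ k ∈ A, p k = 1) (hq1 : ∑ k ∈ A, q k = 1) (hφ0 : ∀ k, 0 ≤ φ k) (hφ1 : ∀ k, φ k ≤ 1) :
    (∑ k ∈ A, p k * φ k - ∑ k ∈ A, q k * φ k) ^ 2 ≤ hellingerSq A p q := by
  have hfactor : ∑ k ∈ A, p k * φ k - ∑ k ∈ A, q k * φ k =
      ∑ k ∈ A, (√(p k) - √(q k)) * ((√(p k) + √(q k)) * (φ k - 1 / 2)) := by
    have hcentre : ∑ k ∈ A, p k * φ k - ∑ k ∈ A, q k * φ k =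
        ∑ k ∈ A, (p k - q k) * (φ k - 1 / 2) := by
      simp only [mul_sub, sub_mul, sum_sub_distrib, ← sum_mul, hp1, hq1]
      ring
    rw [hcentre]
    refine sum_congr rfl fun k _ => ?_
    linear_combination (φ k - 1 / 2) * (Real.sq_sqrt (hq k) - Real.sq_sqrt (hp k))
  have hbound : ∑ k ∈ A, ((√(p k) + √(q k)) * (φ k - 1 / 2)) ^ 2 ≤ 1 := by
    calc ∑ k ∈ A, ((√(p k) + √(q k)) * (φ k - 1 / 2)) ^ 2
        ≤ ∑ k ∈ A, (p k + q k) / 2 := by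
          refine sum_le_sum fun k _ => ?_
          have hsum : (√(p k) + √(q k)) ^ 2 ≤ 2 * (p k + q k) := by
            linarith [add_sq_le (a := √(p k)) (b := √(q k)), Real.sq_sqrt (hp k),
              Real.sq_sqrt (hq k)]
          have hφ : (φ k - 1 / 2) ^ 2 ≤ 1 / 4 := by nlinarith [hφ0 k, hφ1 k]
          rw [mul_pow]
          linarith [mul_le_mul hsum hφ (sq_nonneg _) (by linarith [hp k, hq k])]
      _ = 1 := by rw [← sum_div, sum_add_distrib, hp1, hq1]; norm_num
  rw [hfactor]
  exact (sum_mul_sq_le_sq_mul_sq _ _ _).trans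
    (mul_le_of_le_one_right hellingerSq_nonneg hbound)

/-- The cut-and-paste property: both sides depend only on `∑ √(a b a' b')`. -/
lemma hellingerSq_mul_swap {a a' b b' : K → ℝ} (ha : ∀ k, 0 ≤ a k) (ha' : ∀ k, 0 ≤ a' k)
    (hb : ∀ k, 0 ≤ b k) (hb' : ∀ k, 0 ≤ b' k)
    (h : ∑ k ∈ A, a k * b k + ∑ k ∈ A, a' k * b' k =
      ∑ k ∈ A, a k * b' k + ∑ k ∈ A, a' k * b k) :
    hellingerSq A (fun k => a k * b k) (fun k => a' k * b' k) =
      hellingerSq A (fun k => a k * b' k) (fun k => a' k * b k) := by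
  rw [hellingerSq_eq_sub_sum_sqrt_mul (fun k => mul_nonneg (ha k) (hb k))
      fun k => mul_nonneg (ha' k) (hb' k),
    hellingerSq_eq_sub_sum_sqrt_mul (fun k => mul_nonneg (ha k) (hb' k))
      fun k => mul_nonneg (ha' k) (hb k), h]
  congr 2
  exact sum_congr rfl fun k _ => congrArg Real.sqrt (by ring)

lemma sq_sqrt_sub_sqrt_le_mul_log {a b : ℝ} (ha : 0 ≤ a) (hb : 0 ≤ b) (hab : b = 0 → a = 0) :
    (√a - √b) ^ 2 ≤ a * Real.log (a / b) - a + b := by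
  rcases ha.eq_or_lt with rfl | ha
  · simp [Real.sq_sqrt hb]
  have hb : 0 < b := hb.lt_of_ne fun h => ha.ne' (hab h.symm)
  have hlog : Real.log (a / b) = -2 * Real.log √(b / a) := by
    rw [Real.log_sqrt (by positivity), ← inv_div, Real.log_inv]
    ring
  have hsqrt : a * √(b / a) = √a * √b := by
    rw [Real.sqrt_div hb.le, ← mul_div_assoc, div_eq_iff (by positivity)]
    linear_combination -√b * Real.sq_sqrt ha.le
  have hle := mul_le_mul_of_nonneg_left
    (Real.log_le_sub_one_of_pos (x := √(b / a)) (by positivity)) ha.le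
  rw [hlog]
  linarith [sub_sq √a √b, Real.sq_sqrt ha.le, Real.sq_sqrt hb.le]

lemma hellingerSq_le_sum_mul_log (hp : ∀ k, 0 ≤ p k) (hq : ∀ k, 0 ≤ q k)
    (hpq : ∀ k, q k = 0 → p k = 0) (h : ∑ k ∈ A, q k ≤ ∑ k ∈ A, p k) :
    hellingerSq A p q ≤ ∑ k ∈ A, p k * Real.log (p k / q k) := by
  have hsum := sum_le_sum fun k (_ : k ∈ A) =>
    sq_sqrt_sub_sqrt_le_mul_log (hp k) (hq k) (hpq k)
  rw [sum_add_distrib, sum_sub_distrib] at hsum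
  unfold hellingerSq
  linarith

end Hellinger

section Probability

variable {Ω S : Type*} [Fintype Ω] {p : Ω → ℝ} {E F : Ω → Prop}

lemma prob_nonneg (hp : ∀ ω, 0 ≤ p ω) : 0 ≤ prob p E :=
  sum_nonneg fun ω _ => by split_ifs <;> simp [hp]

lemma prob_congr (h : ∀ ω, p ω ≠ 0 → (E ω ↔ F ω)) : prob p E = prob p F := by
  classical
  refine sum_congr rfl fun ω _ => ?_
  by_cases hω : p ω = 0
  · simp only [hω, ite_self]
  · exact if_congr (h ω hω) rfl rfl

lemma prob_mono (hp : ∀ ω, 0 ≤ p ω) (h : ∀ ω, p ω ≠ 0 → E ω → F ω) : prob p E ≤ prob p F := by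
  refine sum_le_sum fun ω _ => ?_
  split_ifs with hE hF
  · exact le_rfl
  · exact le_of_not_gt fun hω => hF (h ω hω.ne' hE)
  · exact hp ω
  · exact le_rfl

lemma prob_eq_zero (h : ∀ ω, E ω → p ω = 0) : prob p E = 0 :=
  sum_eq_zero fun ω _ => by split_ifs with hE <;> simp [h ω, *]

lemma prob_pos (hp : ∀ ω, 0 ≤ p ω) (E : Ω → Prop) {ω : Ω} (hω : p ω ≠ 0) (h : E ω) :
    0 < prob p E :=
  sum_pos' (fun ω _ => by split_ifs <;> simp [hp])
    ⟨ω, mem_univ ω, by simpa [h] using (hp ω).lt_of_ne' hω⟩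

lemma prob_true (p : Ω → ℝ) : prob p (fun _ => True) = ∑ ω, p ω := by
  simp [prob]

lemma prob_eq_apply (p : Ω → ℝ) (ω : Ω) : prob p (fun ω' => ω' = ω) = p ω := by
  classical
  simp [prob]

lemma prob_add_prob_not (p : Ω → ℝ) (E : Ω → Prop) :
    prob p E + prob p (fun ω => ¬E ω) = ∑ ω, p ω := by
  simp only [prob, ← sum_add_distrib]
  exact sum_congr rfl fun ω _ => by by_cases h : E ω <;> simp [h]

lemma sum_mul_comp (p : Ω → ℝ) {U : Ω → S} {A : Finset S} (hA : ∀ ω, U ω ∈ A) (F : S → ℝ) :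
    ∑ ω, p ω * F (U ω) = ∑ s ∈ A, prob p (fun ω => U ω = s) * F s := by
  classical
  simp only [prob, sum_mul]
  rw [sum_comm]
  exact sum_congr rfl fun ω _ => by simp [ite_mul, hA]

lemma sum_prob_eq (p : Ω → ℝ) {U : Ω → S} {A : Finset S} (hA : ∀ ω, U ω ∈ A) :
    ∑ s ∈ A, prob p (fun ω => U ω = s) = ∑ ω, p ω := by
  simpa using (sum_mul_comp p hA (fun _ => 1)).symm

lemma sum_prob_mul_ite (p : Ω → ℝ) {U : Ω → S} {A : Finset S} (hA : ∀ ω, U ω ∈ A)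
    (E : S → Prop) [DecidablePred E] :
    ∑ s ∈ A, prob p (fun ω => U ω = s) * (if E s then 1 else 0) = prob p (fun ω => E (U ω)) := by
  rw [← sum_mul_comp p hA fun s => if E s then 1 else 0]
  simp only [prob, mul_ite, mul_one, mul_zero]
  congr!

lemma sum_prob_and (p : Ω → ℝ) (E : Ω → Prop) {U : Ω → S} {A : Finset S} (hA : ∀ ω, U ω ∈ A) :
    ∑ s ∈ A, prob p (fun ω => U ω = s ∧ E ω) = prob p E := by
  classical
  simp only [prob]
  rw [sum_comm]
  refine sum_congr rfl fun ω _ => ?_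
  by_cases h : E ω <;> simp [h, hA]

lemma hellingerSq_law_le_sum_log (hp : p ∈ stdSimplex ℝ Ω) {U : Ω → S} {A : Finset S}
    (hA : ∀ ω, U ω ∈ A) {q : S → ℝ} (hq : ∀ s, 0 ≤ q s) (hq1 : ∑ s ∈ A, q s ≤ 1)
    (hpq : ∀ ω, p ω ≠ 0 → q (U ω) ≠ 0) :
    hellingerSq A (fun s => prob p (fun ω => U ω = s)) q ≤
      ∑ ω, p ω * Real.log (prob p (fun ω' => U ω' = U ω) / q (U ω)) := by
  rw [sum_mul_comp p hA fun s => Real.log (prob p (fun ω => U ω = s) / q s)]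
  refine hellingerSq_le_sum_mul_log (fun s => prob_nonneg hp.1) hq
    (fun s hs => prob_eq_zero fun ω hω => ?_) (by rwa [sum_prob_eq p hA, hp.2])
  by_contra h
  exact hpq ω h (hω ▸ hs)

end Probability

section Information

variable {Ω S T W ι B K : Type*} [Fintype Ω] [Fintype ι] {p : Ω → ℝ}

lemma log_two_mul_entropy (p : Ω → ℝ) (U : Ω → S) :
    Real.log 2 * entropy p U = -∑ ω, p ω * Real.log (prob p (fun ω' => U ω' = U ω)) := by
  classical
  have hlog : Real.log 2 ≠ 0 := (Real.log_pos one_lt_two).ne'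
  rw [sum_mul_comp p (A := univ.image U) (by simp)
    fun s => Real.log (prob p (fun ω => U ω = s)), entropy, mul_neg, mul_sum]
  refine congrArg Neg.neg (sum_congr (by congr) fun s _ => ?_)
  rw [Real.logb]
  field_simp

lemma log_two_mul_condMutualInfo (p : Ω → ℝ) (U : Ω → S) (V : Ω → T) (C : Ω → W) :
    Real.log 2 * condMutualInfo p U V C = ∑ ω, p ω *
      (Real.log (prob p (fun ω' => C ω' = C ω))
        + Real.log (prob p (fun ω' => (U ω', C ω') = (U ω, C ω) ∧ V ω' = V ω))
        - Real.log (prob p (fun ω' => (U ω', C ω') = (U ω, C ω)))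
        - Real.log (prob p (fun ω' => V ω' = V ω ∧ C ω' = C ω))) := by
  have hUVC (ω ω' : Ω) : (U ω', V ω', C ω') = (U ω, V ω, C ω) ↔
      (U ω', C ω') = (U ω, C ω) ∧ V ω' = V ω := by
    simp only [Prod.mk.injEq]
    tauto
  simp only [condMutualInfo, mul_sub, mul_add, log_two_mul_entropy, hUVC,
    Prod.mk.injEq (V _), sum_sub_distrib, sum_add_distrib]
  ring

/-- The conditional probability of `E` given `F`, equal to `0` if `F` has probability `0`. -/
noncomputable def condProb (p : Ω → ℝ) (E F : Ω → Prop) : ℝ :=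
  prob p (fun ω => E ω ∧ F ω) / prob p F

lemma condProb_nonneg (hp : ∀ ω, 0 ≤ p ω) {E F : Ω → Prop} : 0 ≤ condProb p E F :=
  div_nonneg (prob_nonneg hp) (prob_nonneg hp)

lemma condProb_pos (hp : ∀ ω, 0 ≤ p ω) (E F : Ω → Prop) {ω : Ω} (hω : p ω ≠ 0) (hE : E ω)
    (hF : F ω) : 0 < condProb p E F :=
  div_pos (prob_pos hp _ hω ⟨hE, hF⟩) (prob_pos hp F hω hF)

lemma sum_condProb_le_one [Fintype B] (p : Ω → ℝ) (V : Ω → B) (F : Ω → Prop) :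
    ∑ v, condProb p (fun ω => V ω = v) F ≤ 1 := by
  simp only [condProb, ← sum_div, sum_prob_and p F (fun ω => mem_univ (V ω))]
  exact div_self_le_one _

/-- Gibbs' inequality for the law of `(D, V)` against the law that resamples the coordinates of `V`
independently given `g D`. -/
lemma sum_log_div_prod_condProb_nonneg [Finite B] (hp : p ∈ stdSimplex ℝ Ω) (D : Ω → S)
    (V : Ω → ι → B) (g : S → K) :
    0 ≤ ∑ ω, p ω * Real.log (prob p (fun ω' => D ω' = D ω ∧ V ω' = V ω) /
      (prob p (fun ω' => D ω' = D ω) *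
        ∏ i, condProb p (fun ω' => V ω' i = V ω i) (fun ω' => g (D ω') = g (D ω)))) := by
  classical
  have := Fintype.ofFinite B
  have hmass (s : S) : ∑ v : ι → B, prob p (fun ω => D ω = s) *
      ∏ i, condProb p (fun ω => V ω i = v i) (fun ω => g (D ω) = g s) ≤
      prob p (fun ω => D ω = s) := by
    rw [← mul_sum, ← Fintype.piFinset_univ, sum_prod_piFinset univ fun i b =>
      condProb p (fun ω => V ω i = b) (fun ω => g (D ω) = g s)]
    exact mul_le_of_le_one_right (prob_nonneg hp.1) (prod_le_one
      (fun i _ => sum_nonneg fun b _ => condProb_nonneg hp.1)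
      fun i _ => sum_condProb_le_one p (fun ω => V ω i) _)
  have hD (ω : Ω) : D ω ∈ univ.image D := mem_image_of_mem D (mem_univ ω)
  have hgibbs := hellingerSq_law_le_sum_log hp (U := fun ω => (D ω, V ω))
    (A := univ.image D ×ˢ univ) (fun ω => mem_product.2 ⟨hD ω, mem_univ _⟩)
    (q := fun s => prob p (fun ω => D ω = s.1) *
      ∏ i, condProb p (fun ω => V ω i = s.2 i) (fun ω => g (D ω) = g s.1))
    (fun s => mul_nonneg (prob_nonneg hp.1) (prod_nonneg fun i _ => condProb_nonneg hp.1))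
    (by
      rw [sum_product]
      exact (sum_le_sum fun s _ => hmass s).trans_eq ((sum_prob_eq p hD).trans hp.2))
    (fun ω hω => (mul_pos (prob_pos hp.1 (fun ω' => D ω' = D ω) hω rfl)
      (prod_pos fun i _ => condProb_pos hp.1 (fun ω' => V ω' i = V ω i)
        (fun ω' => g (D ω') = g (D ω)) hω rfl rfl)).ne')
  simpa only [Prod.mk.injEq] using hellingerSq_nonneg.trans hgibbs

/-- This is the superadditivity of information over independent coordinates. -/
lemma sum_sum_log_le_condMutualInfo [Finite B] (hp : p ∈ stdSimplex ℝ Ω) (U : Ω → S) (V : Ω → ι → B)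
    (C : Ω → W) (g : S → K) (m : ι → B → ℝ)
    (hind : ∀ ω, p ω ≠ 0 → prob p (fun ω' => V ω' = V ω ∧ C ω' = C ω) =
      (∏ i, m i (V ω i)) * prob p (fun ω' => C ω' = C ω)) :
    ∑ i, ∑ ω, p ω * Real.log (prob p (fun ω' => V ω' i = V ω i ∧ g (U ω') = g (U ω)) /
        (m i (V ω i) * prob p (fun ω' => g (U ω') = g (U ω)))) ≤
      Real.log 2 * condMutualInfo p U V C := by
  have hgibbs := sum_log_div_prod_condProb_nonneg hp (fun ω => (U ω, C ω)) V (fun s => g s.1)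
  rw [sum_comm, log_two_mul_condMutualInfo, ← sub_nonneg, ← sum_sub_distrib]
  refine hgibbs.trans_eq (sum_congr rfl fun ω _ => ?_)
  by_cases hω : p ω = 0
  · simp [hω]
  have hpos (E : Ω → Prop) (hE : E ω) : prob p E ≠ 0 := (prob_pos hp.1 E hω hE).ne'
  have hC := hpos (fun ω' => C ω' = C ω) rfl
  have hUC := hpos (fun ω' => (U ω', C ω') = (U ω, C ω)) rfl
  have hUCV := hpos (fun ω' => (U ω', C ω') = (U ω, C ω) ∧ V ω' = V ω) ⟨rfl, rfl⟩
  have hprod : ∏ i, m i (V ω i) ≠ 0 :=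
    left_ne_zero_of_mul (hind ω hω ▸ hpos (fun ω' => V ω' = V ω ∧ C ω' = C ω) ⟨rfl, rfl⟩)
  have hm (i : ι) : m i (V ω i) ≠ 0 := prod_ne_zero_iff.1 hprod i (mem_univ i)
  have hq (i : ι) : condProb p (fun ω' => V ω' i = V ω i)
      (fun ω' => g (U ω') = g (U ω)) ≠ 0 :=
    (condProb_pos hp.1 (fun ω' => V ω' i = V ω i) (fun ω' => g (U ω') = g (U ω)) hω rfl rfl).ne'
  have hcoord (i : ι) : Real.log (prob p (fun ω' => V ω' i = V ω i ∧ g (U ω') = g (U ω)) /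
      (m i (V ω i) * prob p (fun ω' => g (U ω') = g (U ω)))) =
      Real.log (condProb p (fun ω' => V ω' i = V ω i) (fun ω' => g (U ω') = g (U ω))) -
        Real.log (m i (V ω i)) := by
    rw [← Real.log_div (hq i) (hm i), condProb, div_div, mul_comm (m i _)]
  rw [← mul_sum, ← mul_sub, hind ω hω,
    Real.log_div hUCV (mul_ne_zero hUC (prod_ne_zero_iff.2 fun i _ => hq i)),
    Real.log_mul hUC (prod_ne_zero_iff.2 fun i _ => hq i), Real.log_mul hprod hC,
    Real.log_prod fun i _ => hq i, Real.log_prod fun i _ => hm i,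
    sum_congr rfl fun i _ => hcoord i, sum_sub_distrib]
  ring

lemma sum_sum_hellingerSq_le_condMutualInfo [Fintype B] (hp : p ∈ stdSimplex ℝ Ω)
    (U : Ω → S) (V : Ω → ι → B) (C : Ω → W) {g : S → K} {A : Finset K} (hA : ∀ ω, g (U ω) ∈ A)
    {m : ι → B → ℝ} (hm : ∀ i, m i ∈ stdSimplex ℝ B)
    (hind : ∀ ω, p ω ≠ 0 → prob p (fun ω' => V ω' = V ω ∧ C ω' = C ω) =
      (∏ i, m i (V ω i)) * prob p (fun ω' => C ω' = C ω)) :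
    ∑ i, ∑ v, hellingerSq A (fun k => prob p (fun ω => V ω i = v ∧ g (U ω) = k))
        (fun k => m i v * prob p (fun ω => g (U ω) = k)) ≤
      Real.log 2 * condMutualInfo p U V C := by
  refine (sum_le_sum fun i _ => ?_).trans (sum_sum_log_le_condMutualInfo hp U V C g m hind)
  have hlaw := hellingerSq_law_le_sum_log hp (U := fun ω => (V ω i, g (U ω))) (A := univ ×ˢ A)
    (fun ω => mem_product.2 ⟨mem_univ _, hA ω⟩)
    (q := fun s => m i s.1 * prob p (fun ω => g (U ω) = s.2))
    (fun s => mul_nonneg ((hm i).1 _) (prob_nonneg hp.1))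
    (by simp only [sum_product, ← mul_sum, sum_prob_eq p hA, hp.2, mul_one, (hm i).2, le_refl])
    (fun ω hω => by
      have hprod := left_ne_zero_of_mul (hind ω hω ▸
        (prob_pos hp.1 (fun ω' => V ω' = V ω ∧ C ω' = C ω) hω ⟨rfl, rfl⟩).ne')
      exact mul_ne_zero (prod_ne_zero_iff.1 hprod i (mem_univ i))
        (prob_pos hp.1 (fun ω' => g (U ω') = g (U ω)) hω rfl).ne')
  simpa only [hellingerSq, sum_product, Prod.mk.injEq] using hlaw

end Information

section Product

variable {Ω Ω₂ ι B : Type*} [Fintype Ω] [Fintype Ω₂] [Fintype ι] {a : Ω → ℝ} {b : Ω₂ → ℝ}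

/-- The distribution of a pair with independent components distributed as `a` and `b`. -/
noncomputable def prodDist (a : Ω → ℝ) (b : Ω₂ → ℝ) (z : Ω × Ω₂) : ℝ :=
  a z.1 * b z.2

lemma prodDist_mem_stdSimplex (ha : a ∈ stdSimplex ℝ Ω) (hb : b ∈ stdSimplex ℝ Ω₂) :
    prodDist a b ∈ stdSimplex ℝ (Ω × Ω₂) :=
  ⟨fun z => mul_nonneg (ha.1 z.1) (hb.1 z.2), by
    simp only [prodDist, Fintype.sum_prod_type, ← mul_sum, hb.2, mul_one, ha.2]⟩

lemma prob_prodDist_eq_sum (a : Ω → ℝ) (b : Ω₂ → ℝ) (E : Ω × Ω₂ → Prop) :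
    prob (prodDist a b) E = ∑ x, a x * prob b (fun y => E (x, y)) := by
  simp only [prob, prodDist, Fintype.sum_prod_type, mul_sum, mul_ite, mul_zero]

lemma prob_prodDist_and (a : Ω → ℝ) (b : Ω₂ → ℝ) (E : Ω → Prop) (F : Ω₂ → Prop) :
    prob (prodDist a b) (fun z => E z.1 ∧ F z.2) = prob a E * prob b F := by
  rw [prob_prodDist_eq_sum, prob, sum_mul]
  refine sum_congr rfl fun x _ => ?_
  by_cases h : E x
  · simp only [h, true_and, if_true]
  · simp [h, prob]

lemma prob_prodDist_fst (hb : b ∈ stdSimplex ℝ Ω₂) (a : Ω → ℝ) (E : Ω → Prop) :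
    prob (prodDist a b) (fun z => E z.1) = prob a E := by
  simpa only [and_true, prob_true, hb.2, mul_one] using prob_prodDist_and a b E fun _ => True

/-- The distribution of a family with independent coordinates, the `i`-th one distributed as
`m i`. -/
noncomputable def piDist (m : ι → B → ℝ) (x : ι → B) : ℝ :=
  ∏ i, m i (x i)

lemma piDist_mem_stdSimplex [DecidableEq ι] [Fintype B] {m : ι → B → ℝ}
    (hm : ∀ i, m i ∈ stdSimplex ℝ B) : piDist m ∈ stdSimplex ℝ (ι → B) :=
  ⟨fun x => prod_nonneg fun i _ => (hm i).1 (x i), by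
    simp only [piDist, ← Fintype.prod_sum, (hm _).2, prod_const_one]⟩

lemma apply_ne_zero_of_piDist_ne_zero {m : ι → B → ℝ} {x : ι → B} (h : piDist m x ≠ 0) (i : ι) :
    m i (x i) ≠ 0 :=
  prod_ne_zero_iff.1 h i (mem_univ i)

lemma ite_piDist_eq_mul [DecidableEq ι] [DecidableEq B] (m : ι → B → ℝ) (i : ι) (v : B)
    (x : ι → B) : (if x i = v then piDist m x else 0) =
      m i v * piDist (Function.update m i (Pi.single v 1)) x := by
  simp only [piDist, Function.apply_update fun j (q : B → ℝ) => q (x j),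
    prod_update_of_mem (mem_univ i)]
  split_ifs with h
  · rw [← mul_prod_erase univ _ (mem_univ i), h, Pi.single_eq_same, one_mul,
      sdiff_singleton_eq_erase]
  · rw [Pi.single_eq_of_ne h, zero_mul, mul_zero]

end Product

namespace Protocol

variable {X Y Z : Type} (P : Protocol X Y Z)

lemma exists_history_succ_eq (x : X) (y : Y) (a : P.CoinA) (b : P.CoinB) (t : ℕ) :
    ∃ msg, P.history x y a b (t + 1) = P.history x y a b t ++ [msg] := by
  simp only [history]
  cases P.turn (P.history x y a b t) <;> exact ⟨_, rfl⟩

lemma history_eq_of_history_succ_eq {x x' : X} {y y' : Y} {a a' : P.CoinA} {b b' : P.CoinB}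
    {t : ℕ} (h : P.history x y a b (t + 1) = P.history x' y' a' b' (t + 1)) :
    P.history x y a b t = P.history x' y' a' b' t := by
  obtain ⟨msg, hmsg⟩ := P.exists_history_succ_eq x y a b t
  obtain ⟨msg', hmsg'⟩ := P.exists_history_succ_eq x' y' a' b' t
  rw [hmsg, hmsg'] at h
  exact (List.append_inj' h rfl).1

lemma history_cut_paste {x x' : X} {y y' : Y} {a a' : P.CoinA} {b b' : P.CoinB} {t : ℕ}
    (h : P.history x y a b t = P.history x' y' a' b' t) :
    P.history x y' a b' t = P.history x y a b t := by
  induction t with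
  | zero => rfl
  | succ t ih =>
    have hprev := P.history_eq_of_history_succ_eq h
    simp only [history, ih hprev, ← hprev] at h ⊢
    cases hturn : P.turn (P.history x y a b t) with
    | al => rfl
    | bob =>
      simp only [hturn] at h ⊢
      exact h.symm

lemma history_eq_iff (x : X) (y : Y) (a : P.CoinA) (b : P.CoinB) (t : ℕ) (h : History) :
    P.history x y a b t = h ↔
      (∃ y b, P.history x y a b t = h) ∧ ∃ x a, P.history x y a b t = h := by
  refine ⟨fun e => ⟨⟨y, b, e⟩, x, a, e⟩, ?_⟩
  rintro ⟨⟨y', b', e⟩, x', a', e'⟩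
  rw [P.history_cut_paste (e.trans e'.symm), e]

/-- The messages exchanged in the first `t` rounds, as a random variable. -/
def transcript (t : ℕ) (ω : (X × Y) × (P.CoinA × P.CoinB)) : History :=
  P.history ω.1.1 ω.1.2 ω.2.1 ω.2.2 t

lemma coinWeight_mem_stdSimplex : P.coinWeight ∈ stdSimplex ℝ (P.CoinA × P.CoinB) :=
  prodDist_mem_stdSimplex P.coinDistA.2 P.coinDistB.2

/-- Al's factor of the distribution of the transcript if his input is drawn from `a`: the
probability that his input and coins are compatible with the transcript `h`. -/
noncomputable def factorA [Fintype X] (t : ℕ) (a : X → ℝ) (h : History) : ℝ :=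
  prob (prodDist a P.coinDistA.1) (fun z => ∃ y b, P.history z.1 y z.2 b t = h)

/-- Bob's factor of the distribution of the transcript if his input is drawn from `b`: the
probability that his input and coins are compatible with the transcript `h`. -/
noncomputable def factorB [Fintype Y] (t : ℕ) (b : Y → ℝ) (h : History) : ℝ :=
  prob (prodDist b P.coinDistB.1) (fun z => ∃ x a, P.history x z.1 a z.2 t = h)

lemma factorA_nonneg [Fintype X] {a : X → ℝ} (ha : a ∈ stdSimplex ℝ X) (t : ℕ)
    (h : History) : 0 ≤ P.factorA t a h :=
  prob_nonneg (prodDist_mem_stdSimplex ha P.coinDistA.2).1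

lemma factorB_nonneg [Fintype Y] {b : Y → ℝ} (hb : b ∈ stdSimplex ℝ Y) (t : ℕ)
    (h : History) : 0 ≤ P.factorB t b h :=
  prob_nonneg (prodDist_mem_stdSimplex hb P.coinDistB.2).1

variable [Fintype X] [Fintype Y]

/-- The possible values of the transcript after `t` rounds. -/
def transcripts (t : ℕ) : Finset History :=
  univ.image (P.transcript t)

lemma transcript_mem_transcripts (t : ℕ) (ω : (X × Y) × (P.CoinA × P.CoinB)) :
    P.transcript t ω ∈ P.transcripts t :=
  mem_image_of_mem _ (mem_univ ω)

lemma weight_mem_stdSimplex {μ : X × Y → ℝ} (hμ : μ ∈ stdSimplex ℝ (X × Y)) :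
    P.weight μ ∈ stdSimplex ℝ ((X × Y) × (P.CoinA × P.CoinB)) :=
  prodDist_mem_stdSimplex hμ P.coinWeight_mem_stdSimplex

lemma prob_weight_eq_sum (μ : X × Y → ℝ) (E : (X × Y) × (P.CoinA × P.CoinB) → Prop) :
    prob (P.weight μ) E = ∑ z, μ z * prob P.coinWeight (fun c => E (z, c)) :=
  prob_prodDist_eq_sum μ P.coinWeight E

lemma prob_weight_fst (μ : X × Y → ℝ) (E : X × Y → Prop) :
    prob (P.weight μ) (fun ω => E ω.1) = prob μ E :=
  prob_prodDist_fst P.coinWeight_mem_stdSimplex μ E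

lemma prob_weight_prodDist_and (a : X → ℝ) (b : Y → ℝ) (E : X → Prop) (F : Y → Prop) :
    prob (P.weight (prodDist a b)) (fun ω => E ω.1.1 ∧ F ω.1.2) = prob a E * prob b F :=
  (P.prob_weight_fst _ fun z => E z.1 ∧ F z.2).trans (prob_prodDist_and a b E F)

/-- The distribution of the transcript after `t` rounds if the inputs are drawn from `μ`. -/
noncomputable def transcriptLaw (t : ℕ) (μ : X × Y → ℝ) (h : History) : ℝ :=
  prob (P.weight μ) (fun ω => P.transcript t ω = h)

lemma transcriptLaw_nonneg {μ : X × Y → ℝ} (hμ : μ ∈ stdSimplex ℝ (X × Y)) (t : ℕ)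
    (h : History) : 0 ≤ P.transcriptLaw t μ h :=
  prob_nonneg (P.weight_mem_stdSimplex hμ).1

lemma sum_transcriptLaw {μ : X × Y → ℝ} (hμ : μ ∈ stdSimplex ℝ (X × Y)) (t : ℕ) :
    ∑ h ∈ P.transcripts t, P.transcriptLaw t μ h = 1 :=
  (sum_prob_eq _ (P.transcript_mem_transcripts t)).trans (P.weight_mem_stdSimplex hμ).2

lemma prob_weight_and_transcript {μ μ' : X × Y → ℝ} (E : X × Y → Prop) [DecidablePred E] {c : ℝ}
    (hE : ∀ z, (if E z then μ z else 0) = c * μ' z) (t : ℕ) (h : History) :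
    prob (P.weight μ) (fun ω => E ω.1 ∧ P.transcript t ω = h) = c * P.transcriptLaw t μ' h := by
  simp only [transcriptLaw, prob_weight_eq_sum, mul_sum, ← mul_assoc, ← hE]
  refine sum_congr rfl fun z _ => ?_
  by_cases hz : E z
  · simp only [hz, true_and, if_true]
  · simp [hz, prob]

lemma transcriptLaw_prodDist (t : ℕ) (a : X → ℝ) (b : Y → ℝ) (h : History) :
    P.transcriptLaw t (prodDist a b) h = P.factorA t a h * P.factorB t b h := by
  rw [factorA, factorB, ← prob_prodDist_and]
  refine (prob_congr fun ω _ => P.history_eq_iff _ _ _ _ t h).trans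
    (Fintype.sum_equiv (Equiv.prodProdProdComm _ _ _ _) _ _ fun ω => ?_)
  congr 1
  exact mul_mul_mul_comm _ _ _ _

lemma half_hellingerSq_transcriptLaw_le {a a' : X → ℝ} {b b' : Y → ℝ}
    (ha : a ∈ stdSimplex ℝ X) (ha' : a' ∈ stdSimplex ℝ X) (hb : b ∈ stdSimplex ℝ Y)
    (hb' : b' ∈ stdSimplex ℝ Y) (t : ℕ) :
    hellingerSq (P.transcripts t) (P.transcriptLaw t (prodDist a b))
        (P.transcriptLaw t (prodDist a' b')) / 2 ≤
      hellingerSq (P.transcripts t) (P.transcriptLaw t (prodDist a b'))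
          (P.transcriptLaw t (prodDist a b)) +
        hellingerSq (P.transcripts t) (P.transcriptLaw t (prodDist a' b))
          (P.transcriptLaw t (prodDist a b)) := by
  have hswap := hellingerSq_mul_swap (A := P.transcripts t) (P.factorA_nonneg ha t)
    (P.factorA_nonneg ha' t) (P.factorB_nonneg hb t) (P.factorB_nonneg hb' t) (by
      simp only [← transcriptLaw_prodDist, sum_transcriptLaw, prodDist_mem_stdSimplex, *])
  simp only [← transcriptLaw_prodDist] at hswap
  exact hswap ▸ half_hellingerSq_le_add

lemma one_sub_le_prob_run_eq {f : X → Y → Z} {ε : ℝ} (hP : P.Computes f ε) {μ : X × Y → ℝ}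
    (hμ : μ ∈ stdSimplex ℝ (X × Y)) :
    1 - ε ≤ prob (P.weight μ)
      (fun ω => P.run ω.1.1 ω.1.2 ω.2.1 ω.2.2 = f ω.1.1 ω.1.2) := by
  rw [prob_weight_eq_sum]
  calc 1 - ε = ∑ z, μ z * (1 - ε) := by rw [← sum_mul, hμ.2, one_mul]
    _ ≤ _ := sum_le_sum fun z _ => mul_le_mul_of_nonneg_left (hP z.1 z.2) (hμ.1 z)

lemma sq_one_sub_two_mul_le_hellingerSq {f : X → Y → Z} {ε : ℝ} (hP : P.Computes f ε)
    (hε : ε ≤ 1 / 2) {μ μ' : X × Y → ℝ} (hμ : μ ∈ stdSimplex ℝ (X × Y))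
    (hμ' : μ' ∈ stdSimplex ℝ (X × Y)) {c : Z} (hf : ∀ z, μ z ≠ 0 → f z.1 z.2 = c)
    (hf' : ∀ z, μ' z ≠ 0 → f z.1 z.2 ≠ c) :
    (1 - 2 * ε) ^ 2 ≤ hellingerSq (P.transcripts P.rounds) (P.transcriptLaw P.rounds μ)
      (P.transcriptLaw P.rounds μ') := by
  classical
  have hlaw (ν : X × Y → ℝ) : ∑ h ∈ P.transcripts P.rounds, P.transcriptLaw P.rounds ν h *
      (if P.result h = c then 1 else 0) =
      prob (P.weight ν) (fun ω => P.run ω.1.1 ω.1.2 ω.2.1 ω.2.2 = c) :=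
    sum_prob_mul_ite _ (P.transcript_mem_transcripts _) fun h => P.result h = c
  have hc : 1 - ε ≤ prob (P.weight μ) (fun ω => P.run ω.1.1 ω.1.2 ω.2.1 ω.2.2 = c) :=
    (P.one_sub_le_prob_run_eq hP hμ).trans_eq
      (prob_congr fun ω hω => by rw [hf ω.1 (left_ne_zero_of_mul hω)])
  have hc' : prob (P.weight μ') (fun ω => P.run ω.1.1 ω.1.2 ω.2.1 ω.2.2 = c) ≤ ε := by
    have hnot := prob_add_prob_not (P.weight μ')
      (fun ω => P.run ω.1.1 ω.1.2 ω.2.1 ω.2.2 = f ω.1.1 ω.1.2)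
    rw [(P.weight_mem_stdSimplex hμ').2] at hnot
    have hmono := prob_mono (P.weight_mem_stdSimplex hμ').1
      (E := fun ω => P.run ω.1.1 ω.1.2 ω.2.1 ω.2.2 = c)
      (F := fun ω => ¬P.run ω.1.1 ω.1.2 ω.2.1 ω.2.2 = f ω.1.1 ω.1.2)
      fun ω hω hrun => hrun ▸ (hf' ω.1 (left_ne_zero_of_mul hω)).symm
    linarith [P.one_sub_le_prob_run_eq hP hμ']
  have hdist := sq_sum_mul_sub_le_hellingerSq (φ := fun h => if P.result h = c then 1 else 0)
    (P.transcriptLaw_nonneg hμ P.rounds) (P.transcriptLaw_nonneg hμ' P.rounds)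
    (P.sum_transcriptLaw hμ P.rounds) (P.sum_transcriptLaw hμ' P.rounds)
    (fun h => by split_ifs <;> norm_num) (fun h => by split_ifs <;> norm_num)
  rw [hlaw, hlaw] at hdist
  exact (pow_le_pow_left₀ (by linarith) (by linarith) 2).trans hdist

section Information

variable {ι B : Type} [Fintype ι] [DecidableEq ι] [Fintype B] [DecidableEq B] {m : ι → B → ℝ}

lemma sum_sum_hellingerSq_le_divulged_al (P : Protocol X (ι → B) Z) {f : X → (ι → B) → Z} {c : Z}
    {a : X → ℝ} (ha : a ∈ stdSimplex ℝ X) (hm : ∀ i, m i ∈ stdSimplex ℝ B)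
    (hf : ∀ z, prodDist a (piDist m) z ≠ 0 → f z.1 z.2 = c) (t : ℕ) :
    ∑ i, ∑ v, m i v * hellingerSq (P.transcripts t)
        (P.transcriptLaw t (prodDist a (piDist (Function.update m i (Pi.single v 1)))))
        (P.transcriptLaw t (prodDist a (piDist m))) ≤
      Real.log 2 * P.divulged f t (prodDist a (piDist m)) Player.al := by
  have hmpi := piDist_mem_stdSimplex hm
  have hsupp {ω} (hω : P.weight (prodDist a (piDist m)) ω ≠ 0) : f ω.1.1 ω.1.2 = c :=
    hf ω.1 (left_ne_zero_of_mul hω)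
  refine le_trans (le_of_eq ?_) (sum_sum_hellingerSq_le_condMutualInfo
    (P.weight_mem_stdSimplex (prodDist_mem_stdSimplex ha hmpi)) (P.storageA t) (fun ω => ω.1.2)
    (fun ω => (ω.1.1, f ω.1.1 ω.1.2)) (g := Prod.snd)
    (P.transcript_mem_transcripts t) hm fun ω hω => ?_)
  · refine sum_congr rfl fun i _ => sum_congr rfl fun v _ => ?_
    rw [← hellingerSq_const_mul ((hm i).1 v)]
    refine congrArg₂ _ (funext fun h => (P.prob_weight_and_transcript (fun z => z.2 i = v)
      (fun z => ?_) t h).symm) rfl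
    simp only [prodDist, ← mul_ite_zero, ite_piDist_eq_mul, mul_left_comm]
  · have hC ω' (hω' : P.weight (prodDist a (piDist m)) ω' ≠ 0) :
        (ω'.1.1, f ω'.1.1 ω'.1.2) = (ω.1.1, f ω.1.1 ω.1.2) ↔ ω'.1.1 = ω.1.1 := by
      rw [hsupp hω, hsupp hω', Prod.mk.injEq, and_iff_left rfl]
    have hX := P.prob_weight_prodDist_and a (piDist m) (fun x => x = ω.1.1) fun _ => True
    have hXY := P.prob_weight_prodDist_and a (piDist m) (fun x => x = ω.1.1) fun y => y = ω.1.2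
    simp only [and_true, prob_true, hmpi.2, mul_one, prob_eq_apply] at hX hXY
    rw [prob_congr hC, prob_congr fun ω' hω' => and_comm.trans (and_congr_left' (hC ω' hω')), hX,
      hXY]
    exact mul_comm _ _

lemma sum_sum_hellingerSq_le_divulged_bob (P : Protocol (ι → B) Y Z) {f : (ι → B) → Y → Z} {c : Z}
    {b : Y → ℝ} (hm : ∀ i, m i ∈ stdSimplex ℝ B) (hb : b ∈ stdSimplex ℝ Y)
    (hf : ∀ z, prodDist (piDist m) b z ≠ 0 → f z.1 z.2 = c) (t : ℕ) :
    ∑ i, ∑ v, m i v * hellingerSq (P.transcripts t)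
        (P.transcriptLaw t (prodDist (piDist (Function.update m i (Pi.single v 1))) b))
        (P.transcriptLaw t (prodDist (piDist m) b)) ≤
      Real.log 2 * P.divulged f t (prodDist (piDist m) b) Player.bob := by
  have hmpi := piDist_mem_stdSimplex hm
  have hsupp {ω} (hω : P.weight (prodDist (piDist m) b) ω ≠ 0) : f ω.1.1 ω.1.2 = c :=
    hf ω.1 (left_ne_zero_of_mul hω)
  refine le_trans (le_of_eq ?_) (sum_sum_hellingerSq_le_condMutualInfo
    (P.weight_mem_stdSimplex (prodDist_mem_stdSimplex hmpi hb)) (P.storageB t) (fun ω => ω.1.1)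
    (fun ω => (ω.1.2, f ω.1.1 ω.1.2)) (g := Prod.snd)
    (P.transcript_mem_transcripts t) hm fun ω hω => ?_)
  · refine sum_congr rfl fun i _ => sum_congr rfl fun v _ => ?_
    rw [← hellingerSq_const_mul ((hm i).1 v)]
    refine congrArg₂ _ (funext fun h => (P.prob_weight_and_transcript (fun z => z.1 i = v)
      (fun z => ?_) t h).symm) rfl
    simp only [prodDist, ← ite_zero_mul, ite_piDist_eq_mul, mul_assoc]
  · have hC ω' (hω' : P.weight (prodDist (piDist m) b) ω' ≠ 0) :
        (ω'.1.2, f ω'.1.1 ω'.1.2) = (ω.1.2, f ω.1.1 ω.1.2) ↔ ω'.1.2 = ω.1.2 := by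
      rw [hsupp hω, hsupp hω', Prod.mk.injEq, and_iff_left rfl]
    have hY := P.prob_weight_prodDist_and (piDist m) b (fun _ => True) fun y => y = ω.1.2
    have hXY := P.prob_weight_prodDist_and (piDist m) b (fun x => x = ω.1.1) fun y => y = ω.1.2
    simp only [true_and, prob_true, hmpi.2, one_mul, prob_eq_apply] at hY hXY
    rw [prob_congr hC, prob_congr fun ω' hω' => and_congr_right' (hC ω' hω'), hY, hXY]
    rfl

end Information

end Protocol

section RandomSubset

variable {ι : Type*} [DecidableEq ι]

/-- The distribution of the `i`-th bit of a uniformly random subset of `S`: uniform if `i ∈ S`, and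
`false` otherwise. -/
noncomputable def bitDist (S : Finset ι) (i : ι) : Bool → ℝ :=
  if i ∈ S then fun _ => 1 / 2 else Pi.single false 1

lemma bitDist_mem_stdSimplex (S : Finset ι) (i : ι) : bitDist S i ∈ stdSimplex ℝ Bool := by
  unfold bitDist
  split_ifs
  · exact ⟨fun _ => by norm_num, by norm_num⟩
  · exact single_mem_stdSimplex ℝ false

lemma mem_of_bitDist_ne_zero {S : Finset ι} {i : ι} (h : bitDist S i true ≠ 0) : i ∈ S := by
  by_contra hi
  simp [bitDist, hi] at h

lemma hellingerSq_div_four_le_sum_bitDist_mul {K : Type*} {A : Finset K} {S : Finset ι}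
    {i : ι} (hi : i ∈ S) (p : Bool → K → ℝ) (q : K → ℝ) :
    hellingerSq A (p true) (p false) / 4 ≤ ∑ v, bitDist S i v * hellingerSq A (p v) q := by
  simp only [bitDist, if_pos hi, Fintype.sum_bool]
  linarith [half_hellingerSq_le_add (A := A) (p := p true) (q := p false) (r := q)]

variable [Fintype ι]

/-- The distribution of a uniformly random subset of `S` whose `i`-th bit is replaced by `u`. -/
noncomputable def fixedBitDist (S : Finset ι) (i : ι) (u : Bool) : (ι → Bool) → ℝ :=
  piDist (Function.update (bitDist S) i (Pi.single u 1))

lemma fixedBitDist_mem_stdSimplex (S : Finset ι) (i : ι) (u : Bool) :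
    fixedBitDist S i u ∈ stdSimplex ℝ (ι → Bool) := by
  refine piDist_mem_stdSimplex fun j => ?_
  rcases eq_or_ne j i with rfl | hj
  · simpa using single_mem_stdSimplex ℝ u
  · simpa [hj] using bitDist_mem_stdSimplex S j

lemma fixedBitDist_false {S : Finset ι} {i : ι} (hi : i ∉ S) :
    fixedBitDist S i false = piDist (bitDist S) := by
  rw [fixedBitDist, Function.update_eq_self_iff.2]
  rw [bitDist, if_neg hi]

lemma fixedBitDist_congr {S S' : Finset ι} {i : ι} (h : ∀ j ≠ i, (j ∈ S ↔ j ∈ S')) (u : Bool) :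
    fixedBitDist S i u = fixedBitDist S' i u := by
  unfold fixedBitDist
  congr 1
  funext j
  rcases eq_or_ne j i with rfl | hj
  · simp
  · simp [hj, bitDist, h j hj]

lemma eq_of_fixedBitDist_ne_zero {S : Finset ι} {i : ι} {u : Bool} {x : ι → Bool}
    (h : fixedBitDist S i u x ≠ 0) : x i = u := by
  by_contra hx
  simpa [hx] using apply_ne_zero_of_piDist_ne_zero h i

lemma mem_of_fixedBitDist_ne_zero {S : Finset ι} {i : ι} {u : Bool} {x : ι → Bool}
    (h : fixedBitDist S i u x ≠ 0) {j : ι} (hj : j ≠ i) (hx : x j = true) : j ∈ S := by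
  have hxj := apply_ne_zero_of_piDist_ne_zero h j
  rw [Function.update_of_ne hj, hx] at hxj
  exact mem_of_bitDist_ne_zero hxj

lemma card_finset_mul_le_sum {g : Finset ι → ℝ} {c : ℝ} (i : ι)
    (h : ∀ S, i ∉ S → c ≤ g S + g (insert i S)) :
    Fintype.card (Finset ι) * (c / 2) ≤ ∑ S, g S := by
  have hcard : Fintype.card (Finset ι) = 2 * #(univ.erase i).powerset := by
    rw [Fintype.card_finset, card_powerset, ← pow_succ', card_erase_add_one (mem_univ i), card_univ]
  calc Fintype.card (Finset ι) * (c / 2) = ∑ _S ∈ (univ.erase i).powerset, c := by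
        rw [hcard, sum_const, nsmul_eq_mul]
        push_cast
        ring
    _ ≤ ∑ S ∈ (univ.erase i).powerset, (g S + g (insert i S)) :=
        sum_le_sum fun S hS => h S fun hi => notMem_erase i univ (mem_powerset.1 hS hi)
    _ = ∑ S, g S := by
        rw [sum_add_distrib, ← sum_powerset_insert (notMem_erase i univ),
          insert_erase (mem_univ i), powerset_univ]

end RandomSubset

section RandomSplit

variable {ι : Type} [Fintype ι] [DecidableEq ι] {Z : Type} (P : Protocol (ι → Bool) (ι → Bool) Z)

/-- The distribution of a pair of disjoint sets: independent uniformly random subsets of `S` and of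
its complement. -/
noncomputable def splitDist (S : Finset ι) : (ι → Bool) × (ι → Bool) → ℝ :=
  prodDist (piDist (bitDist S)) (piDist (bitDist Sᶜ))

lemma splitDist_mem_stdSimplex (S : Finset ι) : splitDist S ∈ stdSimplex ℝ _ :=
  prodDist_mem_stdSimplex (piDist_mem_stdSimplex (bitDist_mem_stdSimplex S))
    (piDist_mem_stdSimplex (bitDist_mem_stdSimplex Sᶜ))

/-- The distribution of the transcript on uniformly random subsets of `S` and `Sᶜ` whose `i`-th bits
are replaced by `u` and `v`. -/
noncomputable def fixedLaw (S : Finset ι) (i : ι) (u v : Bool) : History → ℝ :=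
  P.transcriptLaw P.rounds (prodDist (fixedBitDist S i u) (fixedBitDist Sᶜ i v))

/-- The influence of the `i`-th bit of the player whose set may contain `i` (Al if `i ∈ S` and Bob
otherwise) on the transcript: the squared Hellinger distance between the transcripts for the two
values of this bit, where `i` is not in the set of the other player. -/
noncomputable def bitInfluence (S : Finset ι) (i : ι) : ℝ :=
  hellingerSq (P.transcripts P.rounds)
    (if i ∈ S then fixedLaw P S i true false else fixedLaw P S i false true)
    (fixedLaw P S i false false)

lemma fixedLaw_insert (S : Finset ι) (i : ι) (u v : Bool) :
    fixedLaw P (insert i S) i u v = fixedLaw P S i u v := by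
  unfold fixedLaw
  congr 2 <;> refine fixedBitDist_congr (fun j hj => ?_) _ <;> simp [hj]

lemma sum_bitInfluence_le {f : (ι → Bool) → (ι → Bool) → Z} {c : Z} {S : Finset ι}
    (hf : ∀ z, splitDist S z ≠ 0 → f z.1 z.2 = c) :
    ∑ i, bitInfluence P S i / 4 ≤
      Real.log 2 * (P.divulged f P.rounds (splitDist S) Player.al +
        P.divulged f P.rounds (splitDist S) Player.bob) := by
  have hal := P.sum_sum_hellingerSq_le_divulged_al
    (piDist_mem_stdSimplex (bitDist_mem_stdSimplex S)) (bitDist_mem_stdSimplex Sᶜ) hf P.rounds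
  have hbob := P.sum_sum_hellingerSq_le_divulged_bob (bitDist_mem_stdSimplex S)
    (piDist_mem_stdSimplex (bitDist_mem_stdSimplex Sᶜ)) hf P.rounds
  rw [mul_add]
  refine le_trans ?_ (add_le_add hal hbob)
  rw [← sum_add_distrib]
  refine sum_le_sum fun i _ => ?_
  have hnonneg (T : Finset ι) (p : Bool → History → ℝ) (q : History → ℝ) :
      0 ≤ ∑ v, bitDist T i v * hellingerSq (P.transcripts P.rounds) (p v) q :=
    sum_nonneg fun v _ => mul_nonneg ((bitDist_mem_stdSimplex T i).1 v) hellingerSq_nonneg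
  by_cases hi : i ∈ S
  · refine le_add_of_nonneg_of_le (hnonneg ..) ?_
    rw [bitInfluence, if_pos hi]
    simp only [fixedLaw, fixedBitDist_false (S := Sᶜ) (i := i) (by simpa using hi)]
    exact hellingerSq_div_four_le_sum_bitDist_mul hi
      (fun v => P.transcriptLaw P.rounds (prodDist (fixedBitDist S i v) _)) _
  · refine le_add_of_le_of_nonneg ?_ (hnonneg ..)
    rw [bitInfluence, if_neg hi]
    simp only [fixedLaw, fixedBitDist_false hi]
    exact hellingerSq_div_four_le_sum_bitDist_mul (mem_compl.2 hi)
      (fun v => P.transcriptLaw P.rounds (prodDist _ (fixedBitDist Sᶜ i v))) _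

end RandomSplit

section Disjointness

variable {n : ℕ} (P : Protocol (Fin n → Bool) (Fin n → Bool) Bool)

lemma disj_eq_true_of_splitDist_ne_zero {S : Finset (Fin n)} {z : (Fin n → Bool) × (Fin n → Bool)}
    (hz : splitDist S z ≠ 0) : disj n z.1 z.2 = true := by
  refine decide_eq_true fun i ⟨hx, hy⟩ => ?_
  have hxS := apply_ne_zero_of_piDist_ne_zero (left_ne_zero_of_mul hz) i
  have hyS := apply_ne_zero_of_piDist_ne_zero (right_ne_zero_of_mul hz) i
  rw [hx] at hxS
  rw [hy] at hyS
  exact mem_compl.1 (mem_of_bitDist_ne_zero hyS) (mem_of_bitDist_ne_zero hxS)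

variable {ε : ℝ} (hε : ε ≤ 1 / 2) (hP : P.Computes (disj n) ε)
include hε hP

lemma sq_one_sub_two_mul_le_hellingerSq_fixedLaw (S : Finset (Fin n)) (i : Fin n) :
    (1 - 2 * ε) ^ 2 ≤ hellingerSq (P.transcripts P.rounds) (fixedLaw P S i false false)
      (fixedLaw P S i true true) := by
  refine P.sq_one_sub_two_mul_le_hellingerSq (c := true) hP hε
    (prodDist_mem_stdSimplex (fixedBitDist_mem_stdSimplex ..) (fixedBitDist_mem_stdSimplex ..))
    (prodDist_mem_stdSimplex (fixedBitDist_mem_stdSimplex ..) (fixedBitDist_mem_stdSimplex ..))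
    (fun z hz => decide_eq_true fun j ⟨hx, hy⟩ => ?_) (fun z hz hdisj => ?_)
  · have hzx := left_ne_zero_of_mul hz
    rcases eq_or_ne j i with rfl | hj
    · simp [eq_of_fixedBitDist_ne_zero hzx] at hx
    · exact mem_compl.1 (mem_of_fixedBitDist_ne_zero (right_ne_zero_of_mul hz) hj hy)
        (mem_of_fixedBitDist_ne_zero hzx hj hx)
  · exact of_decide_eq_true hdisj i ⟨eq_of_fixedBitDist_ne_zero (left_ne_zero_of_mul hz),
      eq_of_fixedBitDist_ne_zero (right_ne_zero_of_mul hz)⟩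

lemma sq_one_sub_two_mul_div_two_le_bitInfluence_add {S : Finset (Fin n)} {i : Fin n}
    (hi : i ∉ S) :
    (1 - 2 * ε) ^ 2 / 2 ≤ bitInfluence P S i + bitInfluence P (insert i S) i := by
  have hrectangle := P.half_hellingerSq_transcriptLaw_le (fixedBitDist_mem_stdSimplex S i false)
    (fixedBitDist_mem_stdSimplex S i true) (fixedBitDist_mem_stdSimplex Sᶜ i false)
    (fixedBitDist_mem_stdSimplex Sᶜ i true) P.rounds
  have hgap := sq_one_sub_two_mul_le_hellingerSq_fixedLaw P hε hP S i
  simp only [bitInfluence, if_neg hi, mem_insert_self, if_true, fixedLaw_insert]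
  exact (div_le_div_of_nonneg_right hgap zero_le_two).trans hrectangle

lemma exists_mul_le_sum_bitInfluence :
    ∃ S : Finset (Fin n), n * ((1 - 2 * ε) ^ 2 / 4) ≤ ∑ i, bitInfluence P S i := by
  suffices h : ∑ _S : Finset (Fin n), n * ((1 - 2 * ε) ^ 2 / 4) ≤
      ∑ S, ∑ i, bitInfluence P S i by
    obtain ⟨S, -, hS⟩ := exists_le_of_sum_le univ_nonempty h
    exact ⟨S, hS⟩
  have havg := sum_le_sum fun (i : Fin n) (_ : i ∈ univ) => card_finset_mul_le_sum
    (g := fun S => bitInfluence P S i) i fun _ hi =>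
    sq_one_sub_two_mul_div_two_le_bitInfluence_add P hε hP hi
  rw [sum_comm]
  refine le_trans (le_of_eq ?_) havg
  simp only [sum_const, card_univ, Fintype.card_fin, nsmul_eq_mul]
  ring

lemma exists_mul_le_divulged :
    ∃ (S : Finset (Fin n)) (i : Player), (1 - 2 * ε) ^ 2 / (32 * Real.log 2) * n ≤
      P.divulged (disj n) P.rounds (splitDist S) i := by
  obtain ⟨S, hS⟩ := exists_mul_le_sum_bitInfluence P hε hP
  have hinfo := sum_bitInfluence_le P fun _ => disj_eq_true_of_splitDist_ne_zero (S := S)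
  rw [← sum_div] at hinfo
  have hlog : 0 < Real.log 2 := Real.log_pos one_lt_two
  by_contra! h
  have hal := mul_lt_mul_of_pos_left (h S Player.al) hlog
  have hbob := mul_lt_mul_of_pos_left (h S Player.bob) hlog
  have hconst : Real.log 2 * ((1 - 2 * ε) ^ 2 / (32 * Real.log 2) * n) =
      n * ((1 - 2 * ε) ^ 2 / 4) / 8 := by
    field_simp
    ring
  linarith

end Disjointness

lemma sqrt_div_logb_le {n : ℕ} (hn : 2 ≤ n) : √n / Real.logb 2 n ≤ n := by
  have hn' : (2 : ℝ) ≤ n := by exact_mod_cast hn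
  have hlogb : 1 ≤ Real.logb 2 n := by
    rwa [Real.le_logb_iff_rpow_le one_lt_two (by linarith), Real.rpow_one]
  exact (div_le_self (Real.sqrt_nonneg _) hlogb).trans
    (Real.sqrt_le_iff.2 ⟨by linarith, by nlinarith⟩)

end ApproxPrivacy

theorem mainTheorem2_general {ε : ℝ} (hε : ε ≤ 1 / 2) (n : ℕ) :
    (((1 - 2 * ε) ^ 2 / (32 * Real.log 2) * n : ℝ) : EReal) ≤
      ApproxPrivacy.classicalPrivacyLoss ε (ApproxPrivacy.disj n) := by
  refine le_iInf₂ fun P hP => ?_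
  obtain ⟨S, i, h⟩ := ApproxPrivacy.exists_mul_le_divulged P hε hP
  exact (EReal.coe_le_coe_iff.2 h).trans (le_iSup₂_of_le P.rounds le_rfl
    (le_iSup₂_of_le i ⟨_, ApproxPrivacy.splitDist_mem_stdSimplex S⟩ le_rfl))

theorem mainTheorem2 :
    ∃ c : ℝ, 0 < c ∧ ∃ N : ℕ, ∀ n : ℕ, N ≤ n →
      ((c * (Real.sqrt n / Real.logb 2 n) : ℝ) : EReal) ≤
        ApproxPrivacy.classicalPrivacyLoss (1 / 3) (ApproxPrivacy.disj n) := by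
  refine ⟨(1 - 2 * (1 / 3)) ^ 2 / (32 * Real.log 2), by positivity, 2, fun n hn => ?_⟩
  refine (EReal.coe_le_coe_iff.2 ?_).trans (mainTheorem2_general (by norm_num) n)
  exact mul_le_mul_of_nonneg_left (ApproxPrivacy.sqrt_div_logb_le hn) (by positivity)
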